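/- Let $m\ge 1$, $[m]=\{1,\dots,m\}$, let $\mathbf k$ be a field of arbitrary characteristic, and let $f:2^{[m]}\to\mathbb Z/2\mathbb Z$ be a function. Write $\mathrm{supp}(g)=g^{-1}(1)$ for $g:2^{[m]}\to\mathbb Z/2\mathbb Z$, and define the Möbius transform of $f$ by $\mathcal M(f)(a)=\sum_{b\subseteq a}f(b)$ for $a\subseteq[m]$. Suppose that $f$ is nice with $K_f=\mathrm{supp}(f)$ an abstract simplicial complex on $[m]$, i.e. every subset (including $\emptyset$) of a member of $K_f$ belongs to $K_f$, and $\bigcup_{a\in K_f}a=[m]$. Let $\mathbf k(K_f)=\mathbf k[v_1,\dots,v_m]/\langle \prod_{i\in\tau}v_i : \tau\subseteq[m],\ \tau\notin K_f\rangle$ be the Stanley–Reisner face ring with its $\mathbb N^m$-grading. Then $\mathbf k(K_f)$ has an $\mathbb N^m$-graded minimal free resolution of finite length over $\mathbf k[\mathbf v]=\mathbf k[v_1,\dots,v_m]$, $$0\leftarrow \mathbf k(K_f)\leftarrow F_0\leftarrow F_1\leftarrow\cdots\leftarrow F_h\leftarrow 0,\qquad F_i=\bigoplus_{\mathbf a\in\mathbb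 N^m}\mathbf k[\mathbf v](-\mathbf a)^{\beta_{i,\mathbf a}},$$ and for every such resolution, with $h$ its length and $\beta_{i,a}^{\mathbf k(K_f)}:=\beta_{i,\mathbf a}$ where $\mathbf a\in\{0,1\}^m$ is the indicator vector of $a\subseteq[m]$ (the Betti numbers of $\mathbf k(K_f)$), $$|\mathrm{supp}(\mathcal M(f))|\le\sum_{i=0}^{h}\sum_{a\in 2^{[m]}}\beta_{i,a}^{\mathbf k(K_f)}.$$ -/

import Mathlib

open MvPolynomial

noncomputable section

namespace FaceRing

/-- The support `f⁻¹(1)` of a `ℤ/2`-valued function on the power set of `[m]`. -/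
def supp {m : ℕ} (f : Finset (Fin m) → ZMod 2) : Finset (Finset (Fin m)) :=
  Finset.univ.filter fun a => f a = 1

/-- `K` is closed under passing to subsets (the empty set counts as a simplex). -/
def IsSimplicialComplex {m : ℕ} (K : Finset (Finset (Fin m))) : Prop :=
  ∀ a ∈ K, ∀ b, b ⊆ a → b ∈ K

/-- The vertex set `⋃_{a ∈ K} a`. -/
def vertexSet {m : ℕ} (K : Finset (Finset (Fin m))) : Finset (Fin m) :=
  K.biUnion id

/-- `f` is nice if its support is an abstract simplicial complex. -/
def IsNice {m : ℕ} (f : Finset (Fin m) → ZMod 2) : Prop :=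
  IsSimplicialComplex (supp f)

/-- The `ℤ/2`-valued Möbius transform. -/
def mobius {m : ℕ} (f : Finset (Fin m) → ZMod 2) : Finset (Fin m) → ZMod 2 :=
  fun a => ∑ b ∈ a.powerset, f b

/-- The exponent vector in `{0,1}^m` with entry `1` exactly at the elements of `a`. -/
def squarefreeVector {m : ℕ} (a : Finset (Fin m)) : Fin m →₀ ℕ :=
  ∑ i ∈ a, Finsupp.single i 1

/-- The Stanley–Reisner ideal, generated by the squarefree monomials of the non-faces of `K`. -/
def stanleyReisnerIdeal (k : Type*) [Field k] {m : ℕ} (K : Finset (Finset (Fin m))) :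
    Ideal (MvPolynomial (Fin m) k) :=
  Ideal.span {p | ∃ τ : Finset (Fin m), τ ∉ K ∧ p = ∏ i ∈ τ, X i}

/-- The Stanley–Reisner face ring. -/
abbrev faceRing (k : Type*) [Field k] {m : ℕ} (K : Finset (Finset (Fin m))) : Type _ :=
  MvPolynomial (Fin m) k ⧸ stanleyReisnerIdeal k K

/-- The component of degree `b` of the face ring, spanned by the class of the monomial `v^b`. -/
def faceRingDegree (k : Type*) [Field k] {m : ℕ} (K : Finset (Finset (Fin m)))
    (b : Fin m →₀ ℕ) : Submodule k (faceRing k K) :=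
  Submodule.span k {Ideal.Quotient.mk (stanleyReisnerIdeal k K) (monomial b 1)}

/-- The component of degree `b` of the graded free module `⨁_j k[v](-deg j)`: the `j`-th
coordinate is a multiple of the monomial `v^c` with `deg j + c = b` (zero if there is no such
`c`). -/
def freeDegree (k : Type*) [Field k] {m r : ℕ} (deg : Fin r → (Fin m →₀ ℕ))
    (b : Fin m →₀ ℕ) : Submodule k (Fin r → MvPolynomial (Fin m) k) :=
  Submodule.pi Set.univ fun j => restrictSupport k {c | deg j + c = b}

/-- An `ℕ^m`-graded minimal free resolution
`0 ← k(K) ← F₀ ← F₁ ← ⋯ ← F_h ← 0` of finite length `h`, where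
`F i = ⨁_{j < rank i} k[v](-deg i j)`. -/
structure MinimalFreeResolution (k : Type*) [Field k] {m : ℕ}
    (K : Finset (Finset (Fin m))) where
  /-- the length `h` -/
  length : ℕ
  /-- the rank of `F i` -/
  rank : ℕ → ℕ
  /-- the degree of the `j`-th basis element of `F i` -/
  deg : ∀ i, Fin (rank i) → (Fin m →₀ ℕ)
  /-- the augmentation `F₀ → k(K)` -/
  aug : (Fin (rank 0) → MvPolynomial (Fin m) k) →ₗ[MvPolynomial (Fin m) k] faceRing k K
  /-- the differential `F (i + 1) → F i` -/
  d : ∀ i, (Fin (rank (i + 1)) → MvPolynomial (Fin m) k) →ₗ[MvPolynomial (Fin m) k]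
    (Fin (rank i) → MvPolynomial (Fin m) k)
  rank_length : rank length ≠ 0
  rank_eq_zero : ∀ i, length < i → rank i = 0
  aug_degree : ∀ b, ∀ x ∈ freeDegree k (deg 0) b, aug x ∈ faceRingDegree k K b
  d_degree : ∀ i b, ∀ x ∈ freeDegree k (deg (i + 1)) b, d i x ∈ freeDegree k (deg i) b
  aug_surjective : Function.Surjective aug
  exact_zero : Function.Exact (d 0) aug
  exact_succ : ∀ i, Function.Exact (d (i + 1)) (d i)
  /-- minimality: the image of each differential lies in `⟨v₁, …, v_m⟩ F i` -/
  minimal : ∀ i x j, constantCoeff (d i x j) = 0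

/-- The Betti number `β_{i,b}`: the multiplicity of `k[v](-b)` as a summand of `F i`. -/
def MinimalFreeResolution.betti {k : Type*} [Field k] {m : ℕ} {K : Finset (Finset (Fin m))}
    (F : MinimalFreeResolution k K) (i : ℕ) (b : Fin m →₀ ℕ) : ℕ :=
  (Finset.univ.filter fun j => F.deg i j = b).card

end FaceRing

end

/-! The inequality comes from an Euler characteristic modulo 2. In a squarefree degree `a` the
resolution is an exact complex of finite-dimensional `k`-spaces. The face ring has dimension 1 there
if `a ∈ K` and 0 otherwise, that is, `f a` modulo 2; `F i` has one dimension for each generator of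
degree at most `a`. Such a degree is the indicator of a subset of `a`, so `f` is the Möbius
transform of the total Betti number `B(c) = ∑ i, β_{i,c}` modulo 2. The transform is an involution,
so `mobius f` is `B` modulo 2, and an odd `B(a)` is at least 1 (`sum_finrank_freeDegree`,
`card_deg_le`, `mobius_eq_sum_betti`).

For existence, syzygy modules are covered repeatedly by irredundant homogeneous generators. Two
invariants carry the construction (`exists_next`): generators can always be chosen in squarefree
degrees, and minimality raises the total degree at each step. A squarefree degree has total degree
at most `m`, so the process stops. -/

noncomputable section

namespace FaceRing

/-! ### Homogeneous components in graded free modules -/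

section Components

variable {k : Type*} [Field k] {m r s : ℕ}

lemma mem_freeDegree {deg : Fin r → (Fin m →₀ ℕ)} {b : Fin m →₀ ℕ}
    {x : Fin r → MvPolynomial (Fin m) k} :
    x ∈ freeDegree k deg b ↔ ∀ j c, coeff c (x j) ≠ 0 → deg j + c = b := by
  simp only [freeDegree, Submodule.mem_pi, Set.mem_univ, true_imp_iff, mem_restrictSupport_iff]
  refine forall_congr' fun j => ⟨fun h c hc => h (by simpa using hc), fun h c hc => ?_⟩
  exact h c (by simpa using hc)

/-- The homogeneous component of degree `b` of an element of `⨁_j k[v](-deg j)`. -/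
def component (deg : Fin r → (Fin m →₀ ℕ)) (b : Fin m →₀ ℕ)
    (x : Fin r → MvPolynomial (Fin m) k) : Fin r → MvPolynomial (Fin m) k :=
  fun j => if deg j ≤ b then monomial (b - deg j) (coeff (b - deg j) (x j)) else 0

lemma coeff_component (deg : Fin r → (Fin m →₀ ℕ)) (b : Fin m →₀ ℕ)
    (x : Fin r → MvPolynomial (Fin m) k) (j : Fin r) (c : Fin m →₀ ℕ) :
    coeff c (component deg b x j) = if deg j + c = b then coeff c (x j) else 0 := by
  unfold component
  by_cases h : deg j ≤ b
  · rw [if_pos h, coeff_monomial]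
    have : b - deg j = c ↔ deg j + c = b := by
      rw [tsub_eq_iff_eq_add_of_le h, add_comm, eq_comm]
    by_cases hc : b - deg j = c
    · rw [if_pos hc, if_pos (this.1 hc), hc]
    · rw [if_neg hc, if_neg (fun h => hc (this.2 h))]
  · rw [if_neg h, if_neg]
    · simp
    · rintro rfl
      exact h le_self_add

lemma component_mem (deg : Fin r → (Fin m →₀ ℕ)) (b : Fin m →₀ ℕ)
    (x : Fin r → MvPolynomial (Fin m) k) : component deg b x ∈ freeDegree k deg b := by
  rw [mem_freeDegree]
  intro j c hc
  rw [coeff_component] at hc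
  by_contra h
  exact hc (if_neg h)

lemma component_of_mem {deg : Fin r → (Fin m →₀ ℕ)} {b : Fin m →₀ ℕ}
    {x : Fin r → MvPolynomial (Fin m) k} (hx : x ∈ freeDegree k deg b) :
    component deg b x = x := by
  funext j
  ext c
  rw [coeff_component]
  split_ifs with h
  · rfl
  · by_contra hc
    exact h (mem_freeDegree.1 hx j c (Ne.symm hc))

lemma component_of_mem_of_ne {deg : Fin r → (Fin m →₀ ℕ)} {b b' : Fin m →₀ ℕ}
    {x : Fin r → MvPolynomial (Fin m) k} (hx : x ∈ freeDegree k deg b') (hb : b ≠ b') :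
    component deg b x = 0 := by
  funext j
  ext c
  rw [coeff_component]
  split_ifs with h
  · by_contra hc
    exact hb (h.symm.trans (mem_freeDegree.1 hx j c hc))
  · simp

lemma component_sum {ι : Type*} (deg : Fin r → (Fin m →₀ ℕ)) (b : Fin m →₀ ℕ) (T : Finset ι)
    (x : ι → Fin r → MvPolynomial (Fin m) k) :
    component deg b (∑ i ∈ T, x i) = ∑ i ∈ T, component deg b (x i) := by
  funext j
  ext c
  simp only [coeff_component, Finset.sum_apply, coeff_sum]
  split_ifs <;> simp

/-- The vanishing off `T` lets a given degree be treated uniformly, whether or not it lies in `T`.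
-/
lemma exists_finset_sum_component (deg : Fin r → (Fin m →₀ ℕ))
    (x : Fin r → MvPolynomial (Fin m) k) :
    ∃ T : Finset (Fin m →₀ ℕ), ∑ b ∈ T, component deg b x = x ∧
      ∀ b ∉ T, component deg b x = 0 := by
  classical
  let T := Finset.univ.biUnion fun j => (x j).support.image (deg j + ·)
  have hT : ∀ j c, coeff c (x j) ≠ 0 → deg j + c ∈ T := fun j c hc =>
    Finset.mem_biUnion.2 ⟨j, Finset.mem_univ _, Finset.mem_image.2 ⟨c, by simpa using hc, rfl⟩⟩
  refine ⟨T, ?_, fun b hb => ?_⟩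
  · funext j
    ext c
    simp only [coeff_component, Finset.sum_apply, coeff_sum, Finset.sum_ite_eq]
    split_ifs with h
    · rfl
    · by_contra hc
      exact h (hT j c (Ne.symm hc))
  · funext j
    ext c
    rw [coeff_component]
    split_ifs with h
    · by_contra hc
      exact hb (h ▸ hT j c hc)
    · simp

/-- A degree preserving map commutes with taking homogeneous components. -/
lemma map_component {deg : Fin r → (Fin m →₀ ℕ)} {deg' : Fin s → (Fin m →₀ ℕ)}
    {d : (Fin s → MvPolynomial (Fin m) k) →ₗ[MvPolynomial (Fin m) k]
      (Fin r → MvPolynomial (Fin m) k)}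
    (hd : ∀ b, ∀ x ∈ freeDegree k deg' b, d x ∈ freeDegree k deg b)
    (b : Fin m →₀ ℕ) (x : Fin s → MvPolynomial (Fin m) k) :
    d (component deg' b x) = component deg b (d x) := by
  classical
  obtain ⟨T, hT, hT'⟩ := exists_finset_sum_component deg' x
  conv_rhs => rw [← hT, map_sum, component_sum]
  have key : ∀ c ∈ T, component deg b (d (component deg' c x)) =
      if b = c then d (component deg' b x) else 0 := by
    intro c _
    split_ifs with h
    · subst h
      exact component_of_mem (hd _ _ (component_mem _ _ _))
    · exact component_of_mem_of_ne (hd _ _ (component_mem _ _ _)) h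
  rw [Finset.sum_congr rfl key, Finset.sum_ite_eq]
  split_ifs with h
  · rfl
  · rw [hT' b h, map_zero]

lemma smul_mem_freeDegree {deg : Fin r → (Fin m →₀ ℕ)} {a b : Fin m →₀ ℕ}
    {p : MvPolynomial (Fin m) k} (hp : ∀ c, coeff c p ≠ 0 → a + c = b)
    {x : Fin r → MvPolynomial (Fin m) k} (hx : x ∈ freeDegree k deg a) :
    p • x ∈ freeDegree k deg b := by
  classical
  rw [mem_freeDegree] at hx ⊢
  intro j c hc
  rw [Pi.smul_apply, smul_eq_mul, coeff_mul] at hc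
  obtain ⟨⟨u, v⟩, huv, hne⟩ := Finset.exists_ne_zero_of_sum_ne_zero hc
  rw [Finset.HasAntidiagonal.mem_antidiagonal] at huv
  have h₁ := hp u (left_ne_zero_of_mul hne)
  have h₂ := hx j v (right_ne_zero_of_mul hne)
  simp only at huv
  rw [← h₁, ← h₂, ← huv, add_assoc, add_comm u v]

/-- If all generators have squarefree degree, multiplication by `X i` is onto the components
of degree `b` with `2 ≤ b i`. -/
lemma exists_X_smul_eq {deg : Fin r → (Fin m →₀ ℕ)} (hdeg : ∀ j i, deg j i ≤ 1)
    {b : Fin m →₀ ℕ} {i : Fin m} (hb : 2 ≤ b i) {x : Fin r → MvPolynomial (Fin m) k}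
    (hx : x ∈ freeDegree k deg b) :
    ∃ y ∈ freeDegree k deg (b - Finsupp.single i 1), (X i : MvPolynomial (Fin m) k) • y = x := by
  classical
  rw [mem_freeDegree] at hx
  refine ⟨fun j => (x j).divMonomial (Finsupp.single i 1), mem_freeDegree.2 fun j c hc => ?_, ?_⟩
  · rw [coeff_divMonomial] at hc
    rw [← hx j _ hc, add_left_comm, add_tsub_cancel_left]
  · funext j
    ext c
    rw [Pi.smul_apply, smul_eq_mul, coeff_X_mul', coeff_divMonomial]
    split_ifs with h
    · rw [add_tsub_cancel_of_le]
      rw [Finsupp.single_le_iff]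
      exact Nat.one_le_iff_ne_zero.2 (Finsupp.mem_support_iff.1 h)
    · by_contra hc
      have h₁ := DFunLike.congr_fun (hx j c (Ne.symm hc)) i
      have h₂ := hdeg j i
      rw [Finsupp.notMem_support_iff] at h
      rw [Finsupp.add_apply] at h₁
      omega

end Components

/-! ### Syzygies with squarefree generators and their minimal covers -/

section Syzygies

variable {k : Type*} [Field k] {m : ℕ}

/-- A graded free module with generators in squarefree degrees of total degree at least `t`,
together with a graded submodule `syz` contained in `⟨v₁, …, v_m⟩ F` from whose elements of
degree `b + e_i` with `0 < b i` the factor `X i` can be cancelled. -/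
structure SquarefreeSyzygy (k : Type*) [Field k] (m t : ℕ) where
  rank : ℕ
  deg : Fin rank → (Fin m →₀ ℕ)
  deg_le_one : ∀ j i, deg j i ≤ 1
  le_degree : ∀ j, t ≤ (deg j).degree
  syz : Submodule (MvPolynomial (Fin m) k) (Fin rank → MvPolynomial (Fin m) k)
  component_mem_syz : ∀ b, ∀ x ∈ syz, component deg b x ∈ syz
  mem_syz_of_X_smul_mem : ∀ i b, ∀ x ∈ freeDegree k deg b, b i ≠ 0 →
    (X i : MvPolynomial (Fin m) k) • x ∈ syz → x ∈ syz
  constantCoeff_eq_zero : ∀ x ∈ syz, ∀ j, constantCoeff (x j) = 0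

namespace SquarefreeSyzygy

variable {t : ℕ}

/-- A squarefree degree has total degree at most `m`. This bounds the length of the resolution. -/
lemma rank_eq_zero (Z : SquarefreeSyzygy k m t) (ht : m < t) : Z.rank = 0 := by
  by_contra h
  let j : Fin Z.rank := ⟨0, Nat.pos_of_ne_zero h⟩
  have h₁ := Z.le_degree j
  have h₂ : (Z.deg j).degree ≤ m := by
    rw [Finsupp.degree_eq_sum]
    exact (Finset.sum_le_sum fun i _ => Z.deg_le_one j i).trans (by simp)
  omega

/-- The homogeneous elements of squarefree degree of `Z.syz`. -/
def squarefreeElements (Z : SquarefreeSyzygy k m t) :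
    Set (Fin Z.rank → MvPolynomial (Fin m) k) :=
  {x | x ∈ Z.syz ∧ ∃ a : Fin m →₀ ℕ, (∀ i, a i ≤ 1) ∧ x ∈ freeDegree k Z.deg a}

/-- Induction on total degree: if `2 ≤ b i`, then `x = X i • y`, and `y` is still a syzygy because
its degree is positive at `i`. -/
lemma mem_span_of_mem_freeDegree (Z : SquarefreeSyzygy k m t) (n : ℕ) :
    ∀ b : Fin m →₀ ℕ, b.degree = n → ∀ x ∈ Z.syz, x ∈ freeDegree k Z.deg b →
      x ∈ Submodule.span (MvPolynomial (Fin m) k) Z.squarefreeElements := by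
  induction n with
  | zero =>
    intro b hb x hx hxb
    rw [Finsupp.degree_eq_zero_iff] at hb
    exact Submodule.subset_span ⟨hx, b, by simp [hb], hxb⟩
  | succ n ih =>
    intro b hb x hx hxb
    by_cases hsq : ∀ i, b i ≤ 1
    · exact Submodule.subset_span ⟨hx, b, hsq, hxb⟩
    push Not at hsq
    obtain ⟨i, hi⟩ := hsq
    obtain ⟨y, hy, rfl⟩ := exists_X_smul_eq Z.deg_le_one hi hxb
    have hle : Finsupp.single i 1 ≤ b := by
      rw [Finsupp.single_le_iff]; omega
    refine Submodule.smul_mem _ _ (ih (b - Finsupp.single i 1) ?_ y ?_ hy)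
    · have h := congrArg Finsupp.degree (tsub_add_cancel_of_le hle)
      rw [map_add, Finsupp.degree_single] at h
      omega
    · refine Z.mem_syz_of_X_smul_mem i _ y hy ?_ hx
      rw [Finsupp.tsub_apply, Finsupp.single_eq_same]
      omega

lemma span_squarefreeElements (Z : SquarefreeSyzygy k m t) :
    Submodule.span (MvPolynomial (Fin m) k) Z.squarefreeElements = Z.syz := by
  apply le_antisymm
  · rw [Submodule.span_le]
    exact fun x hx => hx.1
  · intro x hx
    obtain ⟨T, hT, -⟩ := exists_finset_sum_component Z.deg x
    rw [← hT]
    exact Submodule.sum_mem _ fun b _ => Z.mem_span_of_mem_freeDegree _ b rfl _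
      (Z.component_mem_syz b x hx) (component_mem _ _ _)

/-- There is an irredundant finite generating set of homogeneous elements of squarefree degree. -/
lemma exists_irredundant_generators (Z : SquarefreeSyzygy k m t) :
    ∃ G : Finset (Fin Z.rank → MvPolynomial (Fin m) k), ↑G ⊆ Z.squarefreeElements ∧
      Submodule.span (MvPolynomial (Fin m) k) (G : Set (Fin Z.rank → _)) = Z.syz ∧
      ∀ g ∈ G, g ∉ Submodule.span (MvPolynomial (Fin m) k)
        ((G : Set (Fin Z.rank → MvPolynomial (Fin m) k)) \ {g}) := by
  classical
  have hfg : (Submodule.span (MvPolynomial (Fin m) k) Z.squarefreeElements).FG :=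
    IsNoetherian.noetherian _
  obtain ⟨G₀, hG₀, hspan₀⟩ := (Submodule.fg_span_iff_fg_span_finset_subset _).1 hfg
  rw [span_squarefreeElements] at hspan₀
  obtain ⟨G, ⟨hG, hspan⟩, hmin⟩ := exists_minimal_of_wellFoundedLT
    (fun G : Finset (Fin Z.rank → MvPolynomial (Fin m) k) => ↑G ⊆ Z.squarefreeElements ∧
      Submodule.span (MvPolynomial (Fin m) k) (G : Set (Fin Z.rank → _)) = Z.syz)
    ⟨G₀, hG₀, hspan₀.symm⟩
  refine ⟨G, hG, hspan, fun g hg hmem => ?_⟩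
  have h : G ≤ G.erase g := by
    refine hmin ⟨fun x hx => hG (Finset.erase_subset _ _ hx), ?_⟩ (Finset.erase_subset _ _)
    rw [Finset.coe_erase, ← hspan]
    refine le_antisymm (Submodule.span_mono Set.sdiff_subset) (Submodule.span_le.2 fun x hx => ?_)
    by_cases hxg : x = g
    · exact hxg ▸ hmem
    · exact Submodule.subset_span ⟨hx, hxg⟩
  exact Finset.notMem_erase g G (h hg)

/-- A nonzero coordinate has no constant term, so it contains a nonconstant monomial, which adds at
least 1 to the degree of its generator. -/
lemma lt_degree_of_mem_freeDegree (Z : SquarefreeSyzygy k m t) {a : Fin m →₀ ℕ}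
    {x : Fin Z.rank → MvPolynomial (Fin m) k} (hx : x ∈ Z.syz) (hxa : x ∈ freeDegree k Z.deg a)
    (hne : x ≠ 0) : t + 1 ≤ a.degree := by
  obtain ⟨j, hj⟩ := Function.ne_iff.1 hne
  obtain ⟨c, hc⟩ := MvPolynomial.ne_zero_iff.1 hj
  have hc0 : c ≠ 0 := by
    rintro rfl
    exact hc (Z.constantCoeff_eq_zero x hx j)
  have h₁ : c.degree ≠ 0 := by rwa [Ne, Finsupp.degree_eq_zero_iff]
  have h₂ := Z.le_degree j
  rw [← mem_freeDegree.1 hxa j c hc, map_add]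
  omega

/-- Covering `Z.syz` minimally by a graded free module gives the next syzygy module. -/
theorem exists_next (Z : SquarefreeSyzygy k m t) :
    ∃ (Y : SquarefreeSyzygy k m (t + 1))
      (d : (Fin Y.rank → MvPolynomial (Fin m) k) →ₗ[MvPolynomial (Fin m) k]
        (Fin Z.rank → MvPolynomial (Fin m) k)),
      (∀ b, ∀ x ∈ freeDegree k Y.deg b, d x ∈ freeDegree k Z.deg b) ∧
      LinearMap.range d = Z.syz ∧ LinearMap.ker d = Y.syz := by
  classical
  obtain ⟨G, hG, hspan, hirr⟩ := Z.exists_irredundant_generators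
  let e := G.equivFin.symm
  let g : Fin G.card → Fin Z.rank → MvPolynomial (Fin m) k := fun j => (e j : Fin Z.rank → _)
  have hgG : ∀ j, g j ∈ G := fun j => (e j).2
  have hginj : Function.Injective g := Subtype.val_injective.comp e.injective
  have hgrange : Set.range g = G := by
    ext x
    refine ⟨?_, fun hx => ⟨e.symm ⟨x, hx⟩, by simp [g]⟩⟩
    rintro ⟨j, rfl⟩
    exact hgG j
  choose deg hdeg hgdeg using fun j => (hG (hgG j)).2
  let d := Fintype.linearCombination (MvPolynomial (Fin m) k) g
  have hdapply : ∀ x, d x = ∑ j, x j • g j := fun x => Fintype.linearCombination_apply _ _ _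
  have hd : ∀ b, ∀ x ∈ freeDegree k deg b, d x ∈ freeDegree k Z.deg b := by
    intro b x hx
    rw [hdapply]
    exact Submodule.sum_mem _ fun j _ =>
      smul_mem_freeDegree (mem_freeDegree.1 hx j) (hgdeg j)
  have hrange : LinearMap.range d = Z.syz := by
    rw [Fintype.range_linearCombination, hgrange, hspan]
  have hker : ∀ b, ∀ x ∈ LinearMap.ker d, component deg b x ∈ LinearMap.ker d := by
    intro b x hx
    rw [LinearMap.mem_ker] at hx ⊢
    rw [map_component hd, hx]
    exact component_of_mem (Submodule.zero_mem (freeDegree k Z.deg b))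
  have hmin : ∀ x ∈ LinearMap.ker d, ∀ j, constantCoeff (x j) = 0 := by
    intro x hx j
    by_contra hne
    -- In degree `deg j` the `j`-th coordinate of the relation is a scalar. A nonzero scalar is
    -- invertible and would express `g j` through the other generators.
    have hy := hker (deg j) x hx
    set y := component deg (deg j) x with hydef
    have hyj : y j = C (constantCoeff (x j)) := by
      simp only [hydef, component, le_refl, if_true, tsub_self]
      rfl
    rw [LinearMap.mem_ker, hdapply, ← Finset.add_sum_erase _ _ (Finset.mem_univ j), hyj] at hy
    apply hirr (g j) (hgG j)
    have hmem : (C (constantCoeff (x j)) : MvPolynomial (Fin m) k) • g j ∈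
        Submodule.span (MvPolynomial (Fin m) k)
        ((G : Set (Fin Z.rank → MvPolynomial (Fin m) k)) \ {g j}) := by
      rw [eq_neg_of_add_eq_zero_left hy]
      refine Submodule.neg_mem _ (Submodule.sum_mem _ fun l hl => Submodule.smul_mem _ _
        (Submodule.subset_span ⟨hgG l, fun h => ?_⟩))
      exact (Finset.mem_erase.1 hl).1 (hginj h)
    have := Submodule.smul_mem _ (C (constantCoeff (x j))⁻¹) hmem
    rwa [smul_smul, ← C_mul, inv_mul_cancel₀ hne, C_1, one_smul] at this
  refine ⟨⟨G.card, deg, hdeg, fun j => ?_, LinearMap.ker d, hker, ?_, hmin⟩, d, hd, hrange, rfl⟩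
  · refine Z.lt_degree_of_mem_freeDegree (hG (hgG j)).1 (hgdeg j) fun h => ?_
    exact hirr (g j) (hgG j) (h ▸ Submodule.zero_mem _)
  -- The kernel of a map into a torsion-free module admits cancellation of `X i` in every degree.
  · intro i b x _ _ hx
    rw [LinearMap.mem_ker, map_smul] at hx
    exact (smul_eq_zero.1 hx).resolve_left (X_ne_zero i)

/-- The next syzygy module. -/
def next (Z : SquarefreeSyzygy k m t) : SquarefreeSyzygy k m (t + 1) :=
  Z.exists_next.choose

/-- The minimal graded cover of `Z.syz`. -/
def nextMap (Z : SquarefreeSyzygy k m t) :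
    (Fin Z.next.rank → MvPolynomial (Fin m) k) →ₗ[MvPolynomial (Fin m) k]
      (Fin Z.rank → MvPolynomial (Fin m) k) :=
  Z.exists_next.choose_spec.choose

lemma nextMap_mem_freeDegree (Z : SquarefreeSyzygy k m t) (b : Fin m →₀ ℕ) :
    ∀ x ∈ freeDegree k Z.next.deg b, Z.nextMap x ∈ freeDegree k Z.deg b :=
  Z.exists_next.choose_spec.choose_spec.1 b

lemma range_nextMap (Z : SquarefreeSyzygy k m t) : LinearMap.range Z.nextMap = Z.syz :=
  Z.exists_next.choose_spec.choose_spec.2.1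

lemma ker_nextMap (Z : SquarefreeSyzygy k m t) : LinearMap.ker Z.nextMap = Z.next.syz :=
  Z.exists_next.choose_spec.choose_spec.2.2

lemma exact_nextMap (Z : SquarefreeSyzygy k m t) {M : Type*} [AddCommGroup M]
    [Module (MvPolynomial (Fin m) k) M]
    {φ : (Fin Z.rank → MvPolynomial (Fin m) k) →ₗ[MvPolynomial (Fin m) k] M}
    (hφ : LinearMap.ker φ = Z.syz) : Function.Exact Z.nextMap φ :=
  LinearMap.exact_iff.2 (hφ.trans Z.range_nextMap.symm)

/-- The iterated syzygy modules. -/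
def iterate (Z : SquarefreeSyzygy k m 0) : ∀ n, SquarefreeSyzygy k m n
  | 0 => Z
  | n + 1 => (Z.iterate n).next

end SquarefreeSyzygy

end Syzygies

/-! ### The Stanley–Reisner ideal and existence of the resolution -/

section StanleyReisner

variable {k : Type*} [Field k] {m : ℕ}

lemma squarefreeVector_apply (a : Finset (Fin m)) (i : Fin m) :
    squarefreeVector a i = if i ∈ a then 1 else 0 := by
  simp [squarefreeVector, Finsupp.finsetSum_apply, Finsupp.single_apply]

lemma squarefreeVector_le_iff {a : Finset (Fin m)} {c : Fin m →₀ ℕ} :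
    squarefreeVector a ≤ c ↔ a ⊆ c.support := by
  simp only [Finsupp.le_def, squarefreeVector_apply, Finset.subset_iff, Finsupp.mem_support_iff]
  refine forall_congr' fun i => ?_
  split_ifs with h
  · simp [h, Nat.one_le_iff_ne_zero]
  · simp [h]

lemma support_squarefreeVector (a : Finset (Fin m)) : (squarefreeVector a).support = a := by
  ext i
  simp [squarefreeVector_apply]

/-- For a monomial ideal, membership is tested on each monomial. As `K` is closed under subsets,
`v^c` is divisible by a non-face monomial exactly when its support is a non-face. -/
lemma mem_stanleyReisnerIdeal {K : Finset (Finset (Fin m))} (hK : IsSimplicialComplex K)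
    {p : MvPolynomial (Fin m) k} :
    p ∈ stanleyReisnerIdeal k K ↔ ∀ c, coeff c p ≠ 0 → c.support ∉ K := by
  have hset : {p : MvPolynomial (Fin m) k | ∃ τ : Finset (Fin m), τ ∉ K ∧ p = ∏ i ∈ τ, X i} =
      (fun s => monomial s (1 : k)) ''
        {s | ∃ τ : Finset (Fin m), τ ∉ K ∧ s = squarefreeVector τ} := by
    have h : ∀ τ : Finset (Fin m), monomial (squarefreeVector τ) (1 : k) = ∏ i ∈ τ, X i :=
      fun τ => monomial_sum_one _ _
    ext p
    constructor
    · rintro ⟨τ, hτ, rfl⟩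
      exact ⟨_, ⟨τ, hτ, rfl⟩, h τ⟩
    · rintro ⟨_, ⟨τ, hτ, rfl⟩, rfl⟩
      exact ⟨τ, hτ, h τ⟩
  rw [stanleyReisnerIdeal, hset, mem_ideal_span_monomial_image]
  refine forall_congr' fun c => ?_
  rw [mem_support_iff]
  refine imp_congr_right fun _ =>
    ⟨?_, fun h => ⟨_, ⟨_, h, rfl⟩, squarefreeVector_le_iff.2 subset_rfl⟩⟩
  rintro ⟨_, ⟨τ, hτ, rfl⟩, hle⟩ hc
  exact hτ (hK _ hc _ (squarefreeVector_le_iff.1 hle))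

/-- The augmentation `k[v] → k(K)`, on the free module of rank one. -/
def augmentation (k : Type*) [Field k] {m : ℕ} (K : Finset (Finset (Fin m))) :
    (Fin 1 → MvPolynomial (Fin m) k) →ₗ[MvPolynomial (Fin m) k] faceRing k K :=
  (Submodule.mkQ (stanleyReisnerIdeal k K)).comp (LinearMap.proj 0)

lemma mem_ker_augmentation {K : Finset (Finset (Fin m))} (hK : IsSimplicialComplex K)
    {x : Fin 1 → MvPolynomial (Fin m) k} :
    x ∈ LinearMap.ker (augmentation k K) ↔ ∀ c, coeff c (x 0) ≠ 0 → c.support ∉ K := by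
  rw [← mem_stanleyReisnerIdeal hK, LinearMap.mem_ker, augmentation, LinearMap.comp_apply,
    LinearMap.proj_apply, ← LinearMap.mem_ker, Submodule.ker_mkQ]

/-- The Stanley–Reisner ideal as the first syzygy module of the face ring. -/
def idealSyzygy (k : Type*) [Field k] {m : ℕ} {K : Finset (Finset (Fin m))}
    (hK : IsSimplicialComplex K) (h0 : ∅ ∈ K) : SquarefreeSyzygy k m 0 where
  rank := 1
  deg := 0
  deg_le_one := by simp
  le_degree := by simp
  syz := LinearMap.ker (augmentation k K)
  component_mem_syz b x hx := by
    rw [mem_ker_augmentation hK] at hx ⊢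
    intro c hc
    rw [coeff_component] at hc
    exact hx c fun h => hc (by simp [h])
  mem_syz_of_X_smul_mem i b x hxb hb hx := by
    rw [mem_ker_augmentation hK] at hx ⊢
    intro c hc
    have hcb : c = b := by simpa using mem_freeDegree.1 hxb 0 c hc
    -- Since `b i ≠ 0`, multiplying by `X i` leaves the support unchanged, and membership depends
    -- only on supports.
    have hsupp : (Finsupp.single i 1 + c).support = c.support := by
      ext l
      by_cases hl : l = i
      · subst hl
        simp [hcb, hb]
      · simp [Ne.symm hl]
    rw [← hsupp]
    apply hx
    rwa [Pi.smul_apply, smul_eq_mul, coeff_X_mul]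
  constantCoeff_eq_zero x hx j := by
    rw [mem_ker_augmentation hK] at hx
    by_contra h
    rw [Subsingleton.elim j 0] at h
    exact hx 0 h (by simpa using h0)

theorem nonempty_minimalFreeResolution (k : Type*) [Field k] {m : ℕ}
    {K : Finset (Finset (Fin m))} (hK : IsSimplicialComplex K) (h0 : ∅ ∈ K) :
    Nonempty (MinimalFreeResolution k K) := by
  let Z := (idealSyzygy k hK h0).iterate
  have hrank : ∀ n, m < n → (Z n).rank = 0 := fun n hn => (Z n).rank_eq_zero hn
  -- The length is the last index with nonzero rank; index 0 qualifies, as `Z 0` has rank 1.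
  let h := Nat.findGreatest (fun n => (Z n).rank ≠ 0) m
  refine ⟨{
    length := h
    rank := fun n => (Z n).rank
    deg := fun n => (Z n).deg
    aug := augmentation k K
    d := fun n => (Z n).nextMap
    rank_length := ?_
    rank_eq_zero := ?_
    aug_degree := ?_
    d_degree := fun n b => (Z n).nextMap_mem_freeDegree b
    aug_surjective := ?_
    exact_zero := ?_
    exact_succ := ?_
    minimal := ?_ }⟩
  · exact Nat.findGreatest_spec (P := fun n => (Z n).rank ≠ 0) (Nat.zero_le m) one_ne_zero
  · intro i hi
    by_cases him : i ≤ m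
    · by_contra hne
      exact Nat.findGreatest_is_greatest (P := fun n => (Z n).rank ≠ 0) hi him hne
    · exact hrank i (not_le.1 him)
  · intro b (x : Fin 1 → MvPolynomial (Fin m) k) hx
    have hx' : ∀ c, coeff c (x 0) ≠ 0 → c = b := fun c hc => by
      have := mem_freeDegree.1 hx (0 : Fin 1) c hc
      exact (zero_add c).symm.trans this
    have hx0 : x 0 = coeff b (x 0) • monomial b (1 : k) := by
      ext c
      rw [coeff_smul, coeff_monomial]
      split_ifs with hbc
      · simp [hbc]
      · simpa using mt (hx' c) (Ne.symm hbc)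
    refine Submodule.mem_span_singleton.2 ⟨coeff b (x 0), ?_⟩
    change _ = Submodule.Quotient.mk (x 0)
    rw [hx0]
    simp
    rfl
  · exact (Submodule.mkQ_surjective _).comp (LinearMap.proj_surjective _)
  · exact (Z 0).exact_nextMap (φ := augmentation k K) rfl
  · intro i
    exact (Z (i + 1)).exact_nextMap (Z i).ker_nextMap
  · intro i x j
    exact (Z i).constantCoeff_eq_zero _ ((Z i).range_nextMap ▸ LinearMap.mem_range_self _ x) j

end StanleyReisner

/-! ### Möbius inversion modulo 2 -/

section Mobius

variable {m : ℕ}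

/-- The `ℤ/2`-valued Möbius transform is an involution. -/
lemma mobius_mobius (f : Finset (Fin m) → ZMod 2) : mobius (mobius f) = f := by
  classical
  funext a
  unfold mobius
  rw [Finset.sum_comm' (t' := a.powerset) (s' := fun c => a.powerset.filter (c ⊆ ·))]
  · rw [Finset.sum_eq_single a]
    · have : a.powerset.filter (a ⊆ ·) = {a} := by
        ext b
        simp only [Finset.mem_filter, Finset.mem_powerset, Finset.mem_singleton]
        exact ⟨fun h => h.1.antisymm h.2, fun h => by simp [h]⟩
      simp [this]
    · intro c hc hca
      rw [Finset.mem_powerset] at hc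
      have hIcc : a.powerset.filter (c ⊆ ·) = Finset.Icc c a := by
        ext b
        simp [and_comm]
      -- The interval from `c` to `a` has `2 ^ (a.card - c.card)` elements, an even number when `c ≠
      -- a`.
      rw [hIcc, Finset.sum_const, Finset.card_Icc_finset hc, nsmul_eq_mul]
      have hlt := Finset.card_lt_card (Finset.ssubset_iff_subset_ne.2 ⟨hc, hca⟩)
      obtain ⟨n, hn⟩ : ∃ n, a.card - c.card = n + 1 := ⟨a.card - c.card - 1, by omega⟩
      have h2 : (2 : ZMod 2) = 0 := rfl
      rw [hn, pow_succ]
      push_cast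
      rw [h2, mul_zero, zero_mul]
    · intro h
      simp at h
  · intro b c
    simp only [Finset.mem_powerset, Finset.mem_filter]
    exact ⟨fun h => ⟨⟨h.1, h.2⟩, h.2.trans h.1⟩, fun h => h.1⟩

lemma eq_squarefreeVector_support {a : Finset (Fin m)} {b : Fin m →₀ ℕ}
    (hb : b ≤ squarefreeVector a) : b = squarefreeVector b.support := by
  ext i
  have h := hb i
  rw [squarefreeVector_apply] at h ⊢
  simp only [Finsupp.mem_support_iff]
  split_ifs at * <;> omega

end Mobius

/-! ### Dimensions of graded pieces -/

section Dimension

variable {k : Type*} [Field k] {m r : ℕ}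

/-- The component of degree `b` of `⨁_j k[v](-deg j)` has one coordinate for each generator of
degree at most `b`. -/
def freeDegreeEquiv (k : Type*) [Field k] {m r : ℕ} (deg : Fin r → (Fin m →₀ ℕ))
    (b : Fin m →₀ ℕ) : freeDegree k deg b ≃ₗ[k] ({j // deg j ≤ b} → k) where
  toFun x j := coeff (b - deg j) (x.1 j)
  map_add' x y := by ext; simp
  map_smul' c x := by ext; simp
  invFun u := ⟨fun j => if h : deg j ≤ b then monomial (b - deg j) (u ⟨j, h⟩) else 0, by
    classical
    rw [mem_freeDegree]
    intro j c hc
    split_ifs at hc with h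
    · rw [coeff_monomial] at hc
      split_ifs at hc with h'
      · rw [← h', add_tsub_cancel_of_le h]
      · exact absurd rfl hc
    · simp at hc⟩
  left_inv x := by
    refine Subtype.ext ?_
    conv_rhs => rw [← component_of_mem x.2]
    funext j
    simp only [component, dite_eq_ite]
  right_inv u := by
    funext j
    simp [j.2]

instance (deg : Fin r → (Fin m →₀ ℕ)) (b : Fin m →₀ ℕ) :
    FiniteDimensional k (freeDegree k deg b) :=
  Module.Finite.equiv (freeDegreeEquiv k deg b).symm

lemma finrank_freeDegree (deg : Fin r → (Fin m →₀ ℕ)) (b : Fin m →₀ ℕ) :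
    Module.finrank k (freeDegree k deg b) = (Finset.univ.filter fun j => deg j ≤ b).card := by
  classical
  rw [(freeDegreeEquiv k deg b).finrank_eq, Module.finrank_fintype_fun_eq_card,
    Fintype.card_subtype]

lemma finrank_faceRingDegree {K : Finset (Finset (Fin m))} (hK : IsSimplicialComplex K)
    (a : Finset (Fin m)) :
    Module.finrank k (faceRingDegree k K (squarefreeVector a)) = if a ∈ K then 1 else 0 := by
  classical
  have hmem : monomial (squarefreeVector a) (1 : k) ∈ stanleyReisnerIdeal k K ↔ a ∉ K := by
    rw [mem_stanleyReisnerIdeal hK]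
    simp only [coeff_monomial, ne_eq, ite_eq_right_iff, one_ne_zero, imp_false, not_not]
    constructor
    · intro h
      simpa [support_squarefreeVector] using h _ rfl
    · rintro h c rfl
      rwa [support_squarefreeVector]
  rw [← Ideal.Quotient.eq_zero_iff_mem] at hmem
  unfold faceRingDegree
  split_ifs with h
  · exact finrank_span_singleton fun h0 => hmem.1 h0 h
  · rw [hmem.2 h, Submodule.span_zero_singleton, finrank_bot]

end Dimension

/-! ### Exact strands in a fixed degree and the parity count -/

namespace MinimalFreeResolution

variable {k : Type*} [Field k] {m : ℕ} {K : Finset (Finset (Fin m))}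

/-- The analogue of `map_component` for the face ring. Its degree pieces are only given as spans, so
their independence is recovered from the coefficientwise test for the ideal. -/
lemma aug_component (F : MinimalFreeResolution k K) (hK : IsSimplicialComplex K)
    {x : Fin (F.rank 0) → MvPolynomial (Fin m) k} {q : MvPolynomial (Fin m) k}
    (hx : F.aug x = Ideal.Quotient.mk _ q) (b : Fin m →₀ ℕ) :
    F.aug (component (F.deg 0) b x) = Ideal.Quotient.mk _ (monomial b (coeff b q)) := by
  classical
  have hu : ∀ c, ∃ u : k, Ideal.Quotient.mk (stanleyReisnerIdeal k K) (monomial c u) =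
      F.aug (component (F.deg 0) c x) := by
    intro c
    obtain ⟨u, hu⟩ := Submodule.mem_span_singleton.1
      (F.aug_degree c _ (component_mem (F.deg 0) c x))
    refine ⟨u, ?_⟩
    rw [← hu, ← mul_one u, ← smul_eq_mul, ← smul_monomial]
    simp
    rfl
  choose u hu using hu
  obtain ⟨T, hT, hT'⟩ := exists_finset_sum_component (F.deg 0) x
  -- Inserting `b` ensures that the sum has a term in degree `b`.
  have hsum : ∑ c ∈ insert b T, component (F.deg 0) c x = x :=
    (Finset.sum_subset (Finset.subset_insert _ _) fun c _ hc => hT' c hc).symm.trans hT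
  have hmem : q - ∑ c ∈ insert b T, monomial c (u c) ∈ stanleyReisnerIdeal k K := by
    rw [← Ideal.Quotient.eq, ← hx, ← hsum, map_sum, map_sum]
    exact Finset.sum_congr rfl fun c _ => (hu c).symm
  rw [← hu, Ideal.Quotient.eq, mem_stanleyReisnerIdeal hK]
  intro c hc
  rw [coeff_sub, coeff_monomial, coeff_monomial] at hc
  split_ifs at hc with hbc
  · subst hbc
    refine (mem_stanleyReisnerIdeal hK).1 hmem b fun h0 => hc ?_
    rw [coeff_sub, coeff_sum] at h0
    simp only [coeff_monomial, Finset.sum_ite_eq', Finset.mem_insert_self, if_true] at h0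
    rw [← neg_sub, h0, neg_zero]
  · simp at hc

/-- The differential in degree `b`. -/
def dDegree (F : MinimalFreeResolution k K) (i : ℕ) (b : Fin m →₀ ℕ) :
    freeDegree k (F.deg (i + 1)) b →ₗ[k] freeDegree k (F.deg i) b :=
  ((F.d i).restrictScalars k).restrict (F.d_degree i b)

/-- The augmentation in degree `b`. -/
def augDegree (F : MinimalFreeResolution k K) (b : Fin m →₀ ℕ) :
    freeDegree k (F.deg 0) b →ₗ[k] faceRingDegree k K b :=
  (F.aug.restrictScalars k).restrict (F.aug_degree b)

lemma range_dDegree_succ (F : MinimalFreeResolution k K) (i : ℕ) (b : Fin m →₀ ℕ) :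
    LinearMap.range (F.dDegree (i + 1) b) = LinearMap.ker (F.dDegree i b) := by
  ext x
  rw [LinearMap.mem_ker, Subtype.ext_iff]
  change _ ↔ F.d i x.1 = 0
  rw [F.exact_succ i x.1]
  constructor
  · rintro ⟨y, rfl⟩
    exact ⟨y.1, rfl⟩
  · rintro ⟨y, hy⟩
    refine ⟨⟨component _ b y, component_mem _ _ _⟩, Subtype.ext ?_⟩
    change F.d (i + 1) (component _ b y) = _
    rw [map_component (F.d_degree (i + 1)), hy, component_of_mem x.2]

lemma range_dDegree_zero (F : MinimalFreeResolution k K) (b : Fin m →₀ ℕ) :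
    LinearMap.range (F.dDegree 0 b) = LinearMap.ker (F.augDegree b) := by
  ext x
  rw [LinearMap.mem_ker, Subtype.ext_iff]
  change _ ↔ F.aug x.1 = 0
  rw [F.exact_zero x.1]
  constructor
  · rintro ⟨y, rfl⟩
    exact ⟨y.1, rfl⟩
  · rintro ⟨y, hy⟩
    refine ⟨⟨component _ b y, component_mem _ _ _⟩, Subtype.ext ?_⟩
    change F.d 0 (component _ b y) = _
    rw [map_component (F.d_degree 0), hy, component_of_mem x.2]

lemma augDegree_surjective (F : MinimalFreeResolution k K) (hK : IsSimplicialComplex K)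
    (b : Fin m →₀ ℕ) : Function.Surjective (F.augDegree b) := by
  classical
  rintro ⟨y, hy⟩
  obtain ⟨u, rfl⟩ := Submodule.mem_span_singleton.1 hy
  obtain ⟨x, hx⟩ := F.aug_surjective (Ideal.Quotient.mk _ (monomial b 1))
  refine ⟨u • ⟨component _ b x, component_mem _ _ _⟩, Subtype.ext ?_⟩
  rw [map_smul]
  change u • F.aug (component _ b x) = _
  rw [F.aug_component hK hx, coeff_monomial, if_pos rfl]

/-- The Euler characteristic of the resolution in degree `b`, modulo `2`. -/
lemma sum_finrank_freeDegree (F : MinimalFreeResolution k K) (hK : IsSimplicialComplex K)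
    (b : Fin m →₀ ℕ) :
    ∑ i ∈ Finset.range (F.length + 1), (Module.finrank k (freeDegree k (F.deg i) b) : ZMod 2) =
      Module.finrank k (faceRingDegree k K b) := by
  have h0 := LinearMap.finrank_range_add_finrank_ker (F.augDegree b)
  rw [LinearMap.range_eq_top.2 (F.augDegree_surjective hK b), finrank_top,
    ← range_dDegree_zero] at h0
  have hs : ∀ i, Module.finrank k (LinearMap.range (F.dDegree i b)) +
      Module.finrank k (LinearMap.range (F.dDegree (i + 1) b)) =
        Module.finrank k (freeDegree k (F.deg (i + 1)) b) := by
    intro i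
    rw [range_dDegree_succ]
    exact LinearMap.finrank_range_add_finrank_ker _
  -- Modulo 2 no signs are needed: by rank-nullity and exactness each intermediate rank occurs
  -- twice, and only the last one survives.
  have key : ∀ n, ∑ i ∈ Finset.range (n + 1),
      (Module.finrank k (freeDegree k (F.deg i) b) : ZMod 2) =
        Module.finrank k (faceRingDegree k K b) +
          Module.finrank k (LinearMap.range (F.dDegree n b)) := by
    intro n
    induction n with
    | zero => simp [← h0]
    | succ n ih =>
      rw [Finset.sum_range_succ, ih, ← hs n]
      push_cast
      have h2 := CharTwo.add_self_eq_zero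
        (Module.finrank k (LinearMap.range (F.dDegree n b)) : ZMod 2)
      linear_combination h2
  have hlast : Module.finrank k (LinearMap.range (F.dDegree F.length b)) = 0 := by
    have h1 := hs F.length
    have h2 : Module.finrank k (freeDegree k (F.deg (F.length + 1)) b) = 0 := by
      rw [finrank_freeDegree, Finset.card_eq_zero, Finset.filter_eq_empty_iff]
      intro j
      exact ((Fin.cast (F.rank_eq_zero _ (Nat.lt_succ_self _)) j).elim0)
    omega
  rw [key, hlast, Nat.cast_zero, add_zero]

/-- A degree below a squarefree vector is the indicator of its own support, so generators can be
grouped by support. -/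
lemma card_deg_le (F : MinimalFreeResolution k K) (i : ℕ) (a : Finset (Fin m)) :
    (Finset.univ.filter fun j => F.deg i j ≤ squarefreeVector a).card =
      ∑ c ∈ a.powerset, F.betti i (squarefreeVector c) := by
  classical
  rw [Finset.card_eq_sum_card_fiberwise (f := fun j => (F.deg i j).support) (t := a.powerset)]
  · refine Finset.sum_congr rfl fun c hc => congrArg Finset.card ?_
    ext j
    simp only [Finset.mem_filter, Finset.mem_univ, true_and]
    constructor
    · rintro ⟨h, rfl⟩
      exact eq_squarefreeVector_support h
    · intro h
      rw [h, support_squarefreeVector, squarefreeVector_le_iff, support_squarefreeVector]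
      exact ⟨Finset.mem_powerset.1 hc, rfl⟩
  · intro j hj
    have hle : F.deg i j ≤ squarefreeVector a := by simpa using hj
    have := eq_squarefreeVector_support hle
    rw [this, squarefreeVector_le_iff, support_squarefreeVector] at hle
    simpa using hle

/-- Modulo `2`, the Möbius transform counts the generators of the resolution. -/
theorem mobius_eq_sum_betti {f : Finset (Fin m) → ZMod 2} (hf : IsNice f)
    (F : MinimalFreeResolution k (supp f)) :
    mobius f = fun a => ((∑ i ∈ Finset.range (F.length + 1),
      F.betti i (squarefreeVector a) : ℕ) : ZMod 2) := by
  -- By the involution it suffices that `f` is the transform of the Betti sum.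
  rw [← mobius_mobius fun a => ((∑ i ∈ Finset.range (F.length + 1),
      F.betti i (squarefreeVector a) : ℕ) : ZMod 2)]
  congr 1
  funext a
  have h := F.sum_finrank_freeDegree hf (squarefreeVector a)
  simp only [finrank_freeDegree, card_deg_le, finrank_faceRingDegree hf] at h
  have hfa : f a = ((if a ∈ supp f then 1 else 0 : ℕ) : ZMod 2) := by
    simp only [supp, Finset.mem_filter, Finset.mem_univ, true_and]
    generalize f a = z
    revert z
    decide
  rw [hfa, ← h, mobius]
  push_cast
  exact Finset.sum_comm

end MinimalFreeResolution

end FaceRing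

end

theorem mainTheorem6 (k : Type*) [Field k] (m : ℕ) (hm : 0 < m)
    (f : Finset (Fin m) → ZMod 2) (hf : FaceRing.IsNice f)
    (hV : FaceRing.vertexSet (FaceRing.supp f) = Finset.univ) :
    Nonempty (FaceRing.MinimalFreeResolution k (FaceRing.supp f)) ∧
      ∀ F : FaceRing.MinimalFreeResolution k (FaceRing.supp f),
        (FaceRing.supp (FaceRing.mobius f)).card ≤
          ∑ i ∈ Finset.range (F.length + 1), ∑ a : Finset (Fin m),
            F.betti i (FaceRing.squarefreeVector a) := by
  constructor
  · apply FaceRing.nonempty_minimalFreeResolution k hf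
    -- A vertex forces a face, hence the empty face, so the ideal contains no constants.
    have hmem : (⟨0, hm⟩ : Fin m) ∈ FaceRing.vertexSet (FaceRing.supp f) :=
      hV ▸ Finset.mem_univ _
    obtain ⟨a, ha, -⟩ := Finset.mem_biUnion.1 hmem
    exact hf a ha ∅ (Finset.empty_subset a)
  · intro F
    rw [Finset.sum_comm, Finset.card_eq_sum_ones]
    refine (Finset.sum_le_sum fun a ha => ?_).trans
      (Finset.sum_le_univ_sum_of_nonneg fun _ => Nat.zero_le _)
    rw [Nat.one_le_iff_ne_zero]
    intro h0
    have ha' : FaceRing.mobius f a = 1 := by simpa [FaceRing.supp] using ha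
    rw [F.mobius_eq_sum_betti hf] at ha'
    simp only [h0] at ha'
    exact absurd ha' (by decide)
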